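/- Let $Y$ be a compact metric space and let $S=(S_n)_{n\in\mathbb{N}}$, $\mathbb{N}=\{1,2,3,\dots\}$, be a family of continuous maps $S_n\colon Y\to Y$ with $S_{nm}=S_n\circ S_m$ for all $n,m\in\mathbb{N}$. Say that $S$ is finitely generated if there are finitely many continuous maps $R_1,\dots,R_d\colon Y\to Y$ such that $S_p\in\{R_1,\dots,R_d\}$ for every prime $p$. Say that a Borel probability measure $\nu$ on $Y$ pretends to be invariant under $S$ if there is a set of primes $P$ with $\sum_{p\text{ prime},\,p\notin P}1/p<\infty$ such that $\nu$ is invariant under $S_p$ for all $p\in P$; and say that $(Y,S)$ is strongly uniquely ergodic if there is exactly one Borel probability measure on $Y$ that pretends to be invariant under $S$. **Theorem B.** Suppose that $S$ is finitely generated and that $(Y,S)$ is strongly uniquely ergodic, and let $\nu$ be the unique Borel probability measure on $Y$ that pretends to be invariant under $S$. Then $$\lim_{N\to\infty}\frac1N\sum_{n=1}^N g(S_n y)=\int_Y g\,d\nu$$ for every $y\in Y$ and every continuous function $g\colon Y\to\mathbb{C}$. -/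

import Mathlib

open MeasureTheory Filter Topology

/-- `S = (S_n)_{n ≥ 1}` is an action of the multiplicative semigroup `(ℕ, ·)` of positive integers
on `Y` by continuous maps. The index type `ℕ` of Lean contains `0`; the value `S 0` is
unconstrained and never used. -/
structure IsMulSystem {Y : Type*} [TopologicalSpace Y] (S : ℕ → Y → Y) : Prop where
  continuous : ∀ n : ℕ, 0 < n → Continuous (S n)
  map_mul : ∀ m n : ℕ, 0 < m → 0 < n → S (n * m) = S n ∘ S m

/-- The action `S` is finitely generated: there are finitely many continuous maps `R_1, …, R_d`
such that `S_p ∈ {R_1, …, R_d}` for all primes `p`. -/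
def IsFinitelyGenerated {Y : Type*} [TopologicalSpace Y] (S : ℕ → Y → Y) : Prop :=
  ∃ (d : ℕ) (R : Fin d → Y → Y), (∀ i, Continuous (R i)) ∧
    ∀ p : ℕ, p.Prime → ∃ i, S p = R i

/-- The measure `ν` pretends to be invariant under `S`: there is a set `P` of primes with
`∑_{p ∉ P} 1/p < ∞` (the sum is over primes `p`) such that `ν` is invariant under `S_p` for all
`p ∈ P`. -/
def PretendsInvariant {Y : Type*} [MeasurableSpace Y] (S : ℕ → Y → Y) (ν : Measure Y) : Prop :=
  ∃ P : Set ℕ, (∀ p ∈ P, p.Prime) ∧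
    Summable (fun p : {p : ℕ // p.Prime ∧ p ∉ P} => 1 / ((p : ℕ) : ℝ)) ∧
    ∀ p ∈ P, MeasurePreserving (S p) ν ν

/-- The system is strongly uniquely ergodic: exactly one probability measure on `Y` pretends to be
invariant under `S`. -/
def IsStronglyUniquelyErgodic {Y : Type*} [MeasurableSpace Y] (S : ℕ → Y → Y) : Prop :=
  ∃! ν : ProbabilityMeasure Y, PretendsInvariant S (ν : Measure Y)

/-! By compactness it suffices that every limit `μ` of the empirical measures of an orbit, taken
along an ultrafilter `U`, pretends to be invariant; strong unique ergodicity then forces `μ = ν`.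
Finitely many generators give a finite colouring of the primes, and the sparse colours together form
a sparse set, so only invariance under `S p` for `p` of non-sparse colour is needed.

For `a n = g (S n y)` let `F a t` be the limit along `U` of the mean of `a` over `n ≤ N * exp (-t)`.
The Turán–Kubilius inequality gives `F (dilate p a) (t + log p) → F a t` as `p` avoids sparse sets
(`tendsto_dilate_essentialPrimes`), and `dilate p a` depends only on the colour of `p`. The shift
`log p` has to be removed, that is, `F a` must be shown constant (`IsMeanSystem.eq_const`).

The Lipschitz functions `F a` have a common group of periods. Chebyshev's bounds supply many pairs
`p, q` of one colour with `log (q / p)` in a compact subset of `(0, ∞)`; limit points of these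
logarithms are periods, so the group is not trivial. If it were `αℤ`, then `log p / α` modulo 1
would concentrate at one point per colour, and simultaneous Diophantine approximation would give `ξ
≠ 0` with `cos (ξ log p) ≥ 1/2` off a sparse set. This contradicts the finiteness of `ζ` at `1 +
iξ`. So the periods are dense and `F a` is constant. -/

/-! ### Sparse sets of primes and their filter -/

/-- A set `B` of natural numbers is sparse if `∑ 1/p` converges, the sum being over the primes
in `B`. -/
def SparsePrimes (B : Set ℕ) : Prop :=
  Summable (({p : ℕ | p.Prime} ∩ B).indicator fun n : ℕ => 1 / (n : ℝ))

theorem SparsePrimes.mono {A B : Set ℕ} (hB : SparsePrimes B) (h : A ⊆ B) : SparsePrimes A := by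
  refine Summable.of_nonneg_of_le (fun n => Set.indicator_nonneg (fun _ _ => by positivity) _)
    (fun n => ?_) hB
  exact Set.indicator_le_indicator_of_subset (Set.inter_subset_inter_right _ h)
    (fun _ => by positivity) n

theorem SparsePrimes.union {A B : Set ℕ} (hA : SparsePrimes A) (hB : SparsePrimes B) :
    SparsePrimes (A ∪ B) := by
  refine Summable.of_nonneg_of_le (fun n => Set.indicator_nonneg (fun _ _ => by positivity) _)
    (fun n => ?_) (hA.add hB)
  have h0 : (0 : ℝ) ≤ 1 / (n : ℝ) := by positivity
  by_cases hp : n.Prime <;> by_cases ha : n ∈ A <;> by_cases hb : n ∈ B <;>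
    simp [Set.indicator, hp, ha, hb]

theorem Set.Finite.sparsePrimes {B : Set ℕ} (hB : B.Finite) : SparsePrimes B := by
  refine summable_of_hasFiniteSupport (Set.Finite.subset hB fun n hn => ?_)
  by_contra h
  exact hn (Set.indicator_of_notMem (fun h' => h h'.2) _)

theorem sparsePrimes_of_sum_le {B : Set ℕ} (K : ℝ)
    (h : ∀ T : Finset ℕ, (∀ p ∈ T, p.Prime ∧ p ∈ B) → ∑ p ∈ T, 1 / (p : ℝ) ≤ K) :
    SparsePrimes B := by
  classical
  refine summable_of_sum_le (c := K)
    (fun n => Set.indicator_nonneg (fun _ _ => by positivity) _) (fun T => ?_)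
  simp_rw [Set.indicator_apply]
  rw [← Finset.sum_filter]
  exact h _ (fun p hp => (Finset.mem_filter.1 hp).2)

theorem SparsePrimes.exists_sum_le {B : Set ℕ} (hB : SparsePrimes B) :
    ∃ K : ℝ, 0 ≤ K ∧ ∀ T : Finset ℕ, (∀ p ∈ T, p.Prime ∧ p ∈ B) → ∑ p ∈ T, 1 / (p : ℝ) ≤ K := by
  have h0 : ∀ n, 0 ≤ ({p : ℕ | p.Prime} ∩ B).indicator (fun n : ℕ => 1 / (n : ℝ)) n :=
    fun n => Set.indicator_nonneg (fun _ _ => by positivity) _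
  refine ⟨∑' n, _, tsum_nonneg h0, fun T hT => ?_⟩
  refine le_trans (le_of_eq ?_) (hB.sum_le_tsum T fun n _ => h0 n)
  exact Finset.sum_congr rfl fun p hp =>
    (Set.indicator_of_mem (s := {p : ℕ | p.Prime} ∩ B) (hT p hp) fun n : ℕ => 1 / (n : ℝ)).symm

theorem not_sparsePrimes_univ : ¬ SparsePrimes Set.univ := by
  unfold SparsePrimes
  rw [Set.inter_univ]
  exact not_summable_one_div_on_primes

/-- The filter of sets whose complement is a sparse set of primes. -/
def essentialPrimes : Filter ℕ where
  sets := {A | SparsePrimes Aᶜ}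
  univ_sets := by simpa using Set.finite_empty.sparsePrimes
  sets_of_superset h hs := SparsePrimes.mono h (Set.compl_subset_compl.2 hs)
  inter_sets h h' := by
    have := SparsePrimes.union h h'
    rwa [← Set.compl_inter] at this

theorem mem_essentialPrimes {A : Set ℕ} : A ∈ essentialPrimes ↔ SparsePrimes Aᶜ := Iff.rfl

theorem eventually_essentialPrimes {q : ℕ → Prop} :
    (∀ᶠ p in essentialPrimes, q p) ↔ SparsePrimes {p | ¬ q p} := Iff.rfl

instance : essentialPrimes.NeBot := by
  refine ⟨fun h => not_sparsePrimes_univ ?_⟩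
  have : ∅ ∈ essentialPrimes := h ▸ mem_bot
  simpa [mem_essentialPrimes] using this

theorem eventually_prime_essentialPrimes : ∀ᶠ p in essentialPrimes, p.Prime := by
  refine eventually_essentialPrimes.2 (sparsePrimes_of_sum_le 0 fun T hT => ?_)
  have : T = ∅ := Finset.eq_empty_of_forall_notMem fun p hp => (hT p hp).2 (hT p hp).1
  simp [this]

/-! ### Phases of primes and the zeta function near `Re s = 1` -/

/-- For `ξ ≠ 0`, the sums `∑ cos (ξ log p) / p ^ σ` stay bounded above as `σ` decreases to `1`. -/
theorem exists_tsum_cos_log_div_le {ξ : ℝ} (hξ : ξ ≠ 0) :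
    ∃ K : ℝ, ∀ᶠ σ : ℝ in 𝓝[>] 1,
      ∑' p : Nat.Primes, Real.cos (ξ * Real.log p) * (p : ℝ) ^ (-σ) ≤ K := by
  -- Only continuity of `ζ` at `1 + iξ` is needed: an upper bound for the sum does not require that
  -- `ζ` has no zero there.
  have hcont : ContinuousAt (fun σ : ℝ => riemannZeta (σ + ξ * Complex.I)) 1 := by
    have h1 : ((1 : ℝ) : ℂ) + ξ * Complex.I ≠ 1 := by
      intro h
      have := congrArg Complex.im h
      simp at this
      exact hξ this
    exact ContinuousAt.comp (f := fun σ : ℝ => (σ : ℂ) + ξ * Complex.I)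
      (differentiableAt_riemannZeta h1).continuousAt (by fun_prop)
  set Z := ‖riemannZeta ((1 : ℝ) + ξ * Complex.I)‖ with hZ
  have hbd : ∀ᶠ σ : ℝ in 𝓝 1, ‖riemannZeta (σ + ξ * Complex.I)‖ < Z + 1 :=
    hcont.norm.eventually_lt_const (by simp [hZ])
  have hsq : Summable fun p : Nat.Primes => (p : ℝ) ^ (-2 : ℝ) :=
    Nat.Primes.summable_rpow.2 (by norm_num)
  -- The logarithm bounds `log |ζ(s)|` through the Euler product; the sum over `p ^ (-2)` absorbs
  -- the prime powers of exponent at least 2.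
  refine ⟨Real.log (Z + 1) + ∑' p : Nat.Primes, (p : ℝ) ^ (-2 : ℝ), ?_⟩
  filter_upwards [mem_nhdsWithin_of_mem_nhds hbd, self_mem_nhdsWithin] with σ hσ hσ1
  have hσ1 : 1 < σ := hσ1
  set s : ℂ := σ + ξ * Complex.I with hs
  have hre : 1 < s.re := by simpa [hs] using hσ1
  have hnorm : ∀ p : Nat.Primes, ‖(p : ℂ) ^ (-s)‖ = (p : ℝ) ^ (-σ) := fun p => by
    rw [Complex.norm_natCast_cpow_of_pos p.2.pos]; simp [hs]
  have hreal : ∀ p : Nat.Primes, ((p : ℂ) ^ (-s)).re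
      = Real.cos (ξ * Real.log p) * (p : ℝ) ^ (-σ) := fun p => by
    have hp : (0 : ℝ) < p := by exact_mod_cast p.2.pos
    have hlog : Complex.log (p : ℂ) = (Real.log p : ℂ) := Complex.natCast_log.symm
    rw [Complex.cpow_def_of_ne_zero (by exact_mod_cast p.2.ne_zero), hlog, Complex.exp_re, Real.rpow_def_of_pos hp, mul_comm]
    congr 1
    · rw [← Real.cos_neg]; congr 1; simp [hs, mul_comm, -Complex.natCast_log]
    · simp [hs, -Complex.natCast_log]
  have hle : ∀ p : Nat.Primes, (p : ℝ) ^ (-σ) ≤ 1 / 2 := fun p => by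
    have hp : (2 : ℝ) ≤ p := by exact_mod_cast p.2.two_le
    calc (p : ℝ) ^ (-σ) ≤ (p : ℝ) ^ (-1 : ℝ) :=
          Real.rpow_le_rpow_of_exponent_le (by linarith) (by linarith)
      _ = (p : ℝ)⁻¹ := Real.rpow_neg_one _
      _ ≤ 1 / 2 := by rw [one_div]; exact inv_anti₀ (by norm_num) hp
  have hterm : ∀ p : Nat.Primes, Real.cos (ξ * Real.log p) * (p : ℝ) ^ (-σ)
      ≤ (-Complex.log (1 - (p : ℂ) ^ (-s))).re + (p : ℝ) ^ (-2 : ℝ) := fun p => by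
    have hp : (2 : ℝ) ≤ p := by exact_mod_cast p.2.two_le
    have h1 := Complex.norm_log_one_add_sub_self_le (z := -(p : ℂ) ^ (-s))
      (by rw [norm_neg, hnorm]; linarith [hle p])
    rw [norm_neg, hnorm, ← sub_eq_add_neg] at h1
    have h2 : ((p : ℝ) ^ (-σ)) ^ 2 * (1 - (p : ℝ) ^ (-σ))⁻¹ / 2 ≤ (p : ℝ) ^ (-2 : ℝ) := by
      have h3 : (1 - (p : ℝ) ^ (-σ))⁻¹ ≤ 2 := by
        rw [inv_le_comm₀ (by linarith [hle p]) (by norm_num)]; linarith [hle p]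
      have h4 : ((p : ℝ) ^ (-σ)) ^ 2 ≤ (p : ℝ) ^ (-2 : ℝ) := by
        rw [← Real.rpow_natCast, ← Real.rpow_mul (by linarith)]
        exact Real.rpow_le_rpow_of_exponent_le (by linarith) (by push_cast; linarith)
      nlinarith [sq_nonneg ((p : ℝ) ^ (-σ))]
    have h5 := (Complex.abs_re_le_norm _).trans (h1.trans h2)
    rw [← hreal]
    simp only [Complex.sub_re, Complex.neg_re] at h5 ⊢
    linarith [abs_le.1 h5]
  have hsum : Summable fun p : Nat.Primes => -Complex.log (1 - (p : ℂ) ^ (-s)) := by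
    have := DirichletCharacter.summable_neg_log_one_sub_mul_prime_cpow
      (1 : DirichletCharacter ℂ 1) hre
    simpa [MulChar.one_apply (isUnit_of_subsingleton _)] using this
  have hsumre : Summable fun p : Nat.Primes => (-Complex.log (1 - (p : ℂ) ^ (-s))).re :=
    (Complex.hasSum_re hsum.hasSum).summable
  have hsumcos : Summable fun p : Nat.Primes =>
      Real.cos (ξ * Real.log p) * (p : ℝ) ^ (-σ) := by
    refine Summable.of_norm_bounded (Nat.Primes.summable_rpow.2 (neg_lt_neg hσ1)) fun p => ?_
    rw [norm_mul, Real.norm_eq_abs, Real.norm_eq_abs, abs_of_nonneg (a := (p : ℝ) ^ (-σ))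
      (by positivity)]
    exact mul_le_of_le_one_left (by positivity) (Real.abs_cos_le_one _)
  refine (hsumcos.tsum_le_tsum hterm (hsumre.add hsq)).trans ?_
  rw [hsumre.tsum_add hsq, ← Complex.re_tsum hsum]
  refine add_le_add_left ?_ _
  rw [Real.le_log_iff_exp_le (by positivity), ← Complex.norm_exp,
    riemannZeta_eulerProduct_exp_log hre]
  exact hσ.le

/-- For `ξ ≠ 0`, the phases `ξ log p` cannot concentrate where the cosine is at least `1/2`. -/
theorem not_eventually_half_le_cos_log {ξ : ℝ} (hξ : ξ ≠ 0) :
    ¬ ∀ᶠ p : ℕ in essentialPrimes, 1 / 2 ≤ Real.cos (ξ * Real.log p) := by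
  intro h
  obtain ⟨K, hK⟩ := exists_tsum_cos_log_div_le hξ
  have hB : SparsePrimes {p : ℕ | ¬ 1 / 2 ≤ Real.cos (ξ * Real.log p)} :=
    eventually_essentialPrimes.1 h
  set B : Set ℕ := {p : ℕ | ¬ 1 / 2 ≤ Real.cos (ξ * Real.log p)} with hBdef
  set b : ℕ → ℝ := ({p : ℕ | p.Prime} ∩ B).indicator fun n : ℕ => 1 / (n : ℝ)
  have hb : Summable fun p : Nat.Primes => b p := hB.comp_injective Nat.Primes.coe_nat_injective
  have hb0 : ∀ n, 0 ≤ b n := fun n => Set.indicator_nonneg (fun _ _ => by positivity) _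
  -- Off `B` the cosine is at least `1/2`, whence the factor 2. On `B` it may be `-1`, and `-2 + 2 *
  -- (3/2) = 1` restores the bound.
  set K' := 2 * (K + 3 / 2 * ∑' p : Nat.Primes, b p)
  refine not_sparsePrimes_univ (sparsePrimes_of_sum_le K' fun T hT => ?_)
  have key : ∀ᶠ σ : ℝ in 𝓝[>] 1, ∑ p ∈ T, (p : ℝ) ^ (-σ) ≤ K' := by
    filter_upwards [hK, self_mem_nhdsWithin] with σ hσ hσ1
    have hσ1 : 1 < σ := hσ1
    have hs := Nat.Primes.summable_rpow.2 (neg_lt_neg hσ1)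
    have hsumcos : Summable fun p : Nat.Primes =>
        Real.cos (ξ * Real.log p) * (p : ℝ) ^ (-σ) := by
      refine Summable.of_norm_bounded hs fun p => ?_
      rw [norm_mul, Real.norm_eq_abs, Real.norm_eq_abs, abs_of_nonneg (a := (p : ℝ) ^ (-σ))
        (by positivity)]
      exact mul_le_of_le_one_left (by positivity) (Real.abs_cos_le_one _)
    have hterm : ∀ p : Nat.Primes, (p : ℝ) ^ (-σ)
        ≤ 2 * (Real.cos (ξ * Real.log p) * (p : ℝ) ^ (-σ) + 3 / 2 * b p) := fun p => by
      have hp0 : (0 : ℝ) ≤ (p : ℝ) ^ (-σ) := by positivity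
      by_cases hpB : (p : ℕ) ∈ B
      · have hbp : b p = 1 / (p : ℝ) := 
          Set.indicator_of_mem (show (p : ℕ) ∈ {p : ℕ | p.Prime} ∩ B from ⟨p.2, hpB⟩) _
        have h1 : (p : ℝ) ^ (-σ) ≤ 1 / p := by
          rw [one_div, ← Real.rpow_neg_one]
          exact Real.rpow_le_rpow_of_exponent_le (by exact_mod_cast p.2.one_lt.le) (by linarith)
        rw [hbp]
        nlinarith [Real.neg_one_le_cos (ξ * Real.log p)]
      · have : 1 / 2 ≤ Real.cos (ξ * Real.log p) := not_not.1 hpB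
        nlinarith [hb0 p]
    let T' : Finset Nat.Primes := T.subtype Nat.Prime
    have hsub : ∑ p ∈ T, (p : ℝ) ^ (-σ) = ∑ p ∈ T', (p : ℝ) ^ (-σ) :=
      (Finset.sum_subtype_of_mem _ fun p hp => (hT p hp).1).symm
    rw [hsub]
    have hpos : ∀ p : Nat.Primes, 0 ≤ (p : ℝ) ^ (-σ) := fun p => by positivity
    refine (hs.sum_le_tsum T' fun p _ => hpos p).trans ?_
    have hr := hsumcos.add (hb.mul_left (3 / 2))
    refine (hs.tsum_le_tsum hterm (hr.mul_left 2)).trans ?_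
    rw [tsum_mul_left, hsumcos.tsum_add (hb.mul_left (3 / 2)), tsum_mul_left]
    simp only [K']
    linarith
  have hlim : Tendsto (fun σ : ℝ => ∑ p ∈ T, (p : ℝ) ^ (-σ)) (𝓝[>] 1)
      (𝓝 (∑ p ∈ T, (p : ℝ) ^ (-1 : ℝ))) := by
    refine tendsto_nhdsWithin_of_tendsto_nhds (tendsto_finsetSum _ fun p hp => ?_)
    have hp : (p : ℝ) ≠ 0 := by exact_mod_cast (hT p hp).1.ne_zero
    exact ((continuous_const.rpow continuous_neg fun _ => Or.inl hp).tendsto 1)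
  have := le_of_tendsto hlim key
  simpa [Real.rpow_neg_one] using this

/-! ### Chebyshev's bounds and primes of the same colour -/

/-- A consequence of Chebyshev's bounds: `θ (8 x) - θ x ≥ x` for large `x`. -/
theorem eventually_le_theta_eight_mul_sub_theta :
    ∀ᶠ x : ℝ in atTop, x ≤ Chebyshev.theta (8 * x) - Chebyshev.theta x := by
  have h1 : ∀ᶠ x : ℝ in atTop, ‖Real.log x‖ ≤ (1 / 32) * ‖x ^ (1 / 2 : ℝ)‖ :=
    (isLittleO_log_rpow_atTop (by norm_num)).bound (by norm_num)
  have h2 : Tendsto (fun x : ℝ => 8 * x) atTop atTop :=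
    tendsto_id.const_mul_atTop (by norm_num)
  filter_upwards [h2.eventually h1, eventually_ge_atTop 100] with x hx hx1
  have ht := Chebyshev.theta_ge' (x := 8 * x) (by linarith)
  have ht' := Chebyshev.theta_le_log4_mul_x (x := x) (by linarith)
  rw [← Real.sqrt_eq_rpow, Real.norm_of_nonneg (Real.sqrt_nonneg _),
    Real.norm_of_nonneg (Real.log_nonneg (by linarith))] at hx
  have hs : √(8 * x) * √(8 * x) = 8 * x := Real.mul_self_sqrt (by linarith)
  have hs1 : 1 ≤ √(8 * x) := Real.one_le_sqrt.2 (by linarith)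
  have hlog2 : Real.log (8 * x + 2) ≤ 1 + Real.log (8 * x) := by
    have : 8 * x + 2 ≤ Real.exp 1 * (8 * x) := by
      nlinarith [Real.add_one_le_exp 1]
    calc Real.log (8 * x + 2) ≤ Real.log (Real.exp 1 * (8 * x)) :=
          Real.log_le_log (by linarith) this
      _ = 1 + Real.log (8 * x) := by
          rw [Real.log_mul (Real.exp_ne_zero _) (by linarith), Real.log_exp]
  have hlog4 : Real.log 4 = 2 * Real.log 2 := by
    rw [show (4 : ℝ) = 2 ^ 2 by norm_num, Real.log_pow]; norm_num
  have hl2 := Real.log_two_gt_d9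
  have hl2' := Real.log_two_lt_d9
  rw [hlog4] at ht'
  nlinarith [Real.sqrt_nonneg (8 * x), mul_le_mul_of_nonneg_left hx (Real.sqrt_nonneg (8 * x))]

/-- The primes in `(8 ^ j, 8 ^ (j + 1)]`. -/
def primeBlock (j : ℕ) : Finset ℕ := (Finset.Ioc (8 ^ j) (8 ^ (j + 1))).filter Nat.Prime

theorem mem_primeBlock {j p : ℕ} :
    p ∈ primeBlock j ↔ (8 ^ j < p ∧ p ≤ 8 ^ (j + 1)) ∧ p.Prime := by
  simp [primeBlock]

theorem disjoint_primeBlock {i j : ℕ} (h : i < j) : Disjoint (primeBlock i) (primeBlock j) := by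
  refine Finset.disjoint_left.2 fun p hp hp' => ?_
  have h1 := (mem_primeBlock.1 hp).1.2
  have h2 := (mem_primeBlock.1 hp').1.1
  have h3 : 8 ^ (i + 1) ≤ 8 ^ j := Nat.pow_le_pow_right (by norm_num) h
  omega

/-- The reciprocals of the primes in `(8 ^ j, 8 ^ (j + 1)]` add up to at least a constant times
`1 / (j + 1)`. -/
theorem eventually_le_sum_primeBlock :
    ∀ᶠ j : ℕ in atTop, 1 / (24 * ((j : ℝ) + 1)) ≤ ∑ p ∈ primeBlock j, 1 / (p : ℝ) := by
  have h8 : Tendsto (fun j : ℕ => (8 : ℝ) ^ j) atTop atTop :=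
    tendsto_pow_atTop_atTop_of_one_lt (by norm_num)
  filter_upwards [h8.eventually eventually_le_theta_eight_mul_sub_theta] with j hj
  have hθ : Chebyshev.theta (8 * (8 : ℝ) ^ j) - Chebyshev.theta ((8 : ℝ) ^ j)
      = ∑ p ∈ primeBlock j, Real.log p := by
    have hf : ∀ k : ℕ, ⌊(8 : ℝ) ^ k⌋₊ = 8 ^ k := fun k => by
      have := Nat.floor_natCast (R := ℝ) (8 ^ k)
      simpa using this
    rw [← pow_succ', Chebyshev.theta, Chebyshev.theta, hf, hf, sub_eq_iff_eq_add, primeBlock,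
      ← Finset.sum_union, ← Finset.filter_union, Finset.union_comm, Finset.Ioc_union_Ioc_eq_Ioc]
    · exact Nat.zero_le _
    · exact Nat.pow_le_pow_right (by norm_num) (Nat.le_succ j)
    · refine Finset.disjoint_filter_filter (Finset.disjoint_left.2 fun p hp hp' => ?_)
      exact absurd (Finset.mem_Ioc.1 hp').2 (not_le.2 (Finset.mem_Ioc.1 hp).1)
  rw [hθ] at hj
  have hlog8 : Real.log 8 ≤ 3 := by
    rw [show (8 : ℝ) = 2 ^ 3 by norm_num, Real.log_pow]
    have := Real.log_two_lt_d9
    push_cast; linarith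
  -- Here `p ≤ 8 ^ (j + 1)` and `log p ≤ 3 (j + 1)`; comparison with `θ (8 ^ (j + 1)) - θ (8 ^ j) ≥
  -- 8 ^ j` leaves the constant `24 = 8 * 3`.
  have hterm : ∀ p ∈ primeBlock j,
      Real.log p ≤ (8 : ℝ) ^ (j + 1) * (3 * ((j : ℝ) + 1)) * (1 / (p : ℝ)) := fun p hp => by
    obtain ⟨⟨-, h2⟩, hpp⟩ := mem_primeBlock.1 hp
    have hp0 : (0 : ℝ) < p := by exact_mod_cast hpp.pos
    have h2' : (p : ℝ) ≤ 8 ^ (j + 1) := by exact_mod_cast h2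
    have h3 : Real.log p ≤ 3 * ((j : ℝ) + 1) := by
      refine (Real.log_le_log hp0 h2').trans ?_
      rw [Real.log_pow]; push_cast; nlinarith
    rw [mul_one_div, le_div_iff₀ hp0]
    have := Real.log_nonneg (show (1 : ℝ) ≤ p by exact_mod_cast hpp.one_lt.le)
    calc Real.log p * p ≤ 3 * ((j : ℝ) + 1) * 8 ^ (j + 1) := by gcongr
      _ = _ := by ring
  have h1 := hj.trans (Finset.sum_le_sum hterm)
  rw [← Finset.mul_sum] at h1
  have hpos : (0 : ℝ) < 8 ^ j := by positivity
  rw [div_le_iff₀ (by positivity)]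
  rw [pow_succ] at h1
  have : (8 : ℝ) ^ j * 1 ≤ 8 ^ j * ((∑ p ∈ primeBlock j, 1 / (p : ℝ)) * (24 * ((j : ℝ) + 1))) := by
    linarith
  exact le_of_mul_le_mul_left this hpos

/-- A set of primes with sparse complement meets `k` consecutive blocks of even index. -/
theorem exists_primes_mem_primeBlock {G : Set ℕ} (hG : G ∈ essentialPrimes) (k : ℕ) :
    ∃ m : ℕ, ∀ i < k, ∃ p ∈ primeBlock (m + 2 * i), p ∈ G := by
  by_contra! h
  rcases Nat.eq_zero_or_pos k with rfl | hk
  · obtain ⟨i, hi, -⟩ := h 0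
    omega
  -- Otherwise each window of `k` even indices from `2kJ` contains a block missed by `G`. The missed
  -- blocks contribute at least a constant times `∑ 1 / (J + 1)`, so the complement of `G` is not
  -- sparse.
  choose i hi hbad using fun J : ℕ => h (2 * k * J)
  set b : ℕ → ℕ := fun J => 2 * k * J + 2 * i J with hb
  have hbmono : StrictMono b := strictMono_nat_of_lt_succ fun J => by
    have := hi J
    simp only [hb]
    nlinarith
  have hble : ∀ J, b J + 1 ≤ 2 * k * (J + 1) := fun J => by
    have := hi J
    simp only [hb]
    nlinarith
  obtain ⟨J₀, hJ₀⟩ := eventually_atTop.1 (hbmono.tendsto_atTop.eventually eventually_le_sum_primeBlock)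
  obtain ⟨K, -, hK⟩ := (mem_essentialPrimes.1 hG).exists_sum_le
  have hsum : Summable fun J : ℕ => 1 / (48 * (k : ℝ)) * (1 / ((J + J₀ : ℕ) + 1 : ℝ)) := by
    refine summable_of_sum_range_le (c := K) (fun J => by positivity) fun n => ?_
    have hdis : Set.PairwiseDisjoint (↑(Finset.range n)) fun J => primeBlock (b (J + J₀)) := by
      intro x _ y _ hxy
      rcases lt_or_gt_of_ne hxy with h' | h'
      · exact disjoint_primeBlock (hbmono (by omega))
      · exact (disjoint_primeBlock (hbmono (by omega))).symm
    refine le_trans ?_ (hK ((Finset.range n).biUnion fun J => primeBlock (b (J + J₀))) ?_)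
    · rw [Finset.sum_biUnion hdis]
      refine Finset.sum_le_sum fun J _ => le_trans ?_ (hJ₀ (J + J₀) (by omega))
      have : ((b (J + J₀) : ℕ) : ℝ) + 1 ≤ 2 * k * ((J + J₀ : ℕ) + 1) := by
        exact_mod_cast hble (J + J₀)
      rw [one_div_mul_one_div]
      refine one_div_le_one_div_of_le (by positivity) ?_
      linarith
    · intro p hp
      obtain ⟨J, -, hJ⟩ := Finset.mem_biUnion.1 hp
      exact ⟨(mem_primeBlock.1 hJ).2, hbad _ p hJ⟩
  have hk' : (1 / (48 * (k : ℝ))) ≠ 0 := by positivity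
  rw [summable_mul_left_iff hk'] at hsum
  refine Real.not_summable_one_div_natCast ((summable_nat_add_iff (J₀ + 1)).1 ?_)
  refine hsum.congr fun J => ?_
  push_cast
  ring_nf

/-- For any colouring of the primes by finitely many colours, essentially many pairs of primes of
the same colour have a quotient that is bounded and bounded away from `1`. -/
theorem neBot_essentialPrimes_prod {ι : Type*} [Finite ι] (κ : ℕ → ι) :
    ∃ u v : ℝ, 0 < u ∧
      ((essentialPrimes ×ˢ essentialPrimes) ⊓ 𝓟 {z : ℕ × ℕ | κ z.1 = κ z.2 ∧
        Real.log z.2 - Real.log z.1 ∈ Set.Icc u v}).NeBot := by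
  have := Fintype.ofFinite ι
  set d := Fintype.card ι
  -- Among `d + 1` primes from blocks of even index two share a colour. Their block indices differ
  -- by at least 2 and at most `2d`, and a block has logarithmic length `log 8`.
  refine ⟨Real.log 8, (2 * d + 1) * Real.log 8, Real.log_pos (by norm_num), ?_⟩
  rw [inf_principal_neBot_iff]
  intro W hW
  obtain ⟨G, hG, hGW⟩ := (essentialPrimes.basis_sets.prod_self).mem_iff.1 hW
  obtain ⟨m, hm⟩ := exists_primes_mem_primeBlock hG (d + 1)
  choose p hp hpG using fun i : Fin (d + 1) => hm i i.2
  obtain ⟨i, j, hij, hκ⟩ := Fintype.exists_ne_map_eq_of_card_lt (fun i => κ (p i)) (by simp [d])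
  wlog hlt : i < j generalizing i j
  · exact this j i hij.symm hκ.symm (lt_of_le_of_ne (not_lt.1 hlt) hij.symm)
  refine ⟨(p i, p j), hGW ⟨hpG i, hpG j⟩, hκ, ?_⟩
  have hlt' : (i : ℕ) < j := hlt
  have hlog : ∀ i : Fin (d + 1), (m + 2 * (i : ℕ) : ℕ) * Real.log 8 ≤ Real.log (p i) ∧
      Real.log (p i) ≤ (m + 2 * (i : ℕ) + 1 : ℕ) * Real.log 8 := fun i => by
    obtain ⟨⟨h1, h2⟩, h3⟩ := mem_primeBlock.1 (hp i)
    rw [← Real.log_pow, ← Real.log_pow]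
    exact ⟨Real.log_le_log (by positivity) (by exact_mod_cast h1.le),
      Real.log_le_log (by exact_mod_cast h3.pos) (by exact_mod_cast h2)⟩
  have h8 : 0 < Real.log 8 := Real.log_pos (by norm_num)
  have hi := hlog i
  have hj := hlog j
  push_cast at hi hj
  have h1 : (i : ℝ) + 1 ≤ j := by exact_mod_cast hlt'
  have h2 : (j : ℝ) ≤ d := by exact_mod_cast Nat.lt_succ_iff.1 j.2
  have h3 : (0 : ℝ) ≤ i := by positivity
  constructor <;> simp only <;> nlinarith

/-! ### Periods of the mean value functions -/

/-- The sequence `n ↦ a (p n)`. -/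
def dilate (p : ℕ) (a : ℕ → ℝ) : ℕ → ℝ := fun n => a (p * n)

/-- The common periods of the functions `F a`, for `a ∈ 𝒜`. -/
def commonPeriods (𝒜 : Set (ℕ → ℝ)) (F : (ℕ → ℝ) → ℝ → ℝ) : AddSubgroup ℝ where
  carrier := {u | ∀ a ∈ 𝒜, ∀ t, F a (t + u) = F a t}
  zero_mem' := fun a _ t => by rw [add_zero]
  add_mem' := fun {u v} hu hv a ha t => by rw [← add_assoc, hv a ha, hu a ha]
  neg_mem' := fun {u} hu a ha t => by rw [← hu a ha (t + -u), neg_add_cancel_right]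

theorem mem_commonPeriods {𝒜 : Set (ℕ → ℝ)} {F : (ℕ → ℝ) → ℝ → ℝ} {u : ℝ} :
    u ∈ commonPeriods 𝒜 F ↔ ∀ a ∈ 𝒜, ∀ t, F a (t + u) = F a t := Iff.rfl

/-- The properties of a family `𝒜` of bounded sequences and of its mean value functions `F a` that
force these functions to be constant. -/
structure IsMeanSystem {ι : Type*} (𝒜 : Set (ℕ → ℝ)) (F : (ℕ → ℝ) → ℝ → ℝ) (κ : ℕ → ι) :
    Prop where
  bounded : ∀ a ∈ 𝒜, ∃ M, ∀ n, |a n| ≤ M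
  dilate_mem : ∀ a ∈ 𝒜, ∀ p : ℕ, p.Prime → dilate p a ∈ 𝒜
  dilate_eq : ∀ a ∈ 𝒜, ∀ p q : ℕ, p.Prime → q.Prime → κ p = κ q → dilate p a = dilate q a
  lipschitz : ∀ a ∈ 𝒜, ∀ M, (∀ n, |a n| ≤ M) → ∀ s t, |F a s - F a t| ≤ 2 * M * |s - t|
  tendsto : ∀ a ∈ 𝒜, ∀ t, Tendsto (fun p : ℕ => F (dilate p a) (t + Real.log p)) essentialPrimes
    (𝓝 (F a t))

/-- The powers of an element of a compact torus return arbitrarily close to the identity. -/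
theorem exists_pow_forall_half_le_cos {ι : Type*} [Finite ι] (c : ι → ℝ) :
    ∃ k : ℕ, 0 < k ∧ ∀ i, 1 / 2 < Real.cos (2 * Real.pi * k * c i) := by
  have hcl := mapClusterPt_one_atTop_pow (fun i => Circle.exp (2 * Real.pi * c i))
  have hopen : ∀ᶠ z : ι → Circle in 𝓝 1, ∀ i, 1 / 2 < (z i : ℂ).re := by
    refine eventually_all.2 fun i => ?_
    have hc : ContinuousAt (fun z : ι → Circle => (z i : ℂ).re) 1 :=
      (Complex.continuous_re.comp (continuous_induced_dom.comp (continuous_apply i))).continuousAt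
    exact hc.eventually_const_lt (by norm_num)
  obtain ⟨k, hk, hk0⟩ := ((mapClusterPt_iff_frequently.1 hcl _ hopen).and_eventually
    (eventually_gt_atTop 0)).exists
  refine ⟨k, hk0, fun i => ?_⟩
  have := hk i
  rw [Pi.pow_apply, ← Circle.exp_nsmul, Circle.coe_exp, Complex.exp_ofReal_mul_I_re] at this
  rw [nsmul_eq_mul] at this
  convert this using 2
  ring

namespace IsMeanSystem

variable {ι : Type*} {𝒜 : Set (ℕ → ℝ)} {F : (ℕ → ℝ) → ℝ → ℝ} {κ : ℕ → ι}

theorem continuous (h : IsMeanSystem 𝒜 F κ) {a : ℕ → ℝ} (ha : a ∈ 𝒜) : Continuous (F a) := by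
  obtain ⟨M, hM⟩ := h.bounded a ha
  have hM0 : 0 ≤ M := (abs_nonneg _).trans (hM 0)
  refine (LipschitzWith.of_dist_le_mul (K := Real.toNNReal (2 * M)) fun s t => ?_).continuous
  rw [Real.coe_toNNReal _ (by positivity)]
  exact h.lipschitz a ha M hM s t

/-- There is a nonzero common period. -/
theorem exists_pos_mem_commonPeriods [Finite ι] (h : IsMeanSystem 𝒜 F κ) :
    ∃ u ∈ commonPeriods 𝒜 F, 0 < u := by
  obtain ⟨u₀, v₀, hu₀, hne⟩ := neBot_essentialPrimes_prod κ
  set W := Ultrafilter.of ((essentialPrimes ×ˢ essentialPrimes) ⊓ 𝓟 {z : ℕ × ℕ | κ z.1 = κ z.2 ∧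
        Real.log z.2 - Real.log z.1 ∈ Set.Icc u₀ v₀})
  have hW := Ultrafilter.of_le ((essentialPrimes ×ˢ essentialPrimes) ⊓
    𝓟 {z : ℕ × ℕ | κ z.1 = κ z.2 ∧ Real.log z.2 - Real.log z.1 ∈ Set.Icc u₀ v₀})
  have hWP : ∀ᶠ z in (W : Filter (ℕ × ℕ)), κ z.1 = κ z.2 ∧
      Real.log z.2 - Real.log z.1 ∈ Set.Icc u₀ v₀ :=
    le_principal_iff.1 (hW.trans inf_le_right)
  have hW1 : Tendsto Prod.fst (W : Filter (ℕ × ℕ)) essentialPrimes :=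
    tendsto_fst.mono_left (hW.trans inf_le_left)
  have hW2 : Tendsto Prod.snd (W : Filter (ℕ × ℕ)) essentialPrimes :=
    tendsto_snd.mono_left (hW.trans inf_le_left)
  obtain ⟨u, hu, hWu⟩ := isCompact_Icc.ultrafilter_le_nhds
    (W.map fun z : ℕ × ℕ => Real.log z.2 - Real.log z.1)
    (le_principal_iff.2 (hWP.mono fun z hz => hz.2))
  have hWu : Tendsto (fun z : ℕ × ℕ => Real.log z.2 - Real.log z.1) W (𝓝 u) := hWu
  refine ⟨u, fun a ha t => ?_, hu₀.trans_le hu.1⟩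
  obtain ⟨M, hM⟩ := h.bounded a ha
  have h1 := (h.tendsto a ha (t + u)).comp hW1
  have h2 := (h.tendsto a ha t).comp hW2
  have h3 : Tendsto (fun z : ℕ × ℕ => 2 * M * |u - (Real.log z.2 - Real.log z.1)|) W (𝓝 0) := by
    have := ((tendsto_const_nhds (x := u)).sub hWu).abs.const_mul (2 * M)
    simpa using this
  -- Equal colours make the two dilates the same function, so the Lipschitz bound sees only the
  -- distance from `log q - log p` to its limit `u`.
  have h4 : Tendsto (fun z : ℕ × ℕ => F (dilate z.1 a) (t + u + Real.log z.1) -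
      F (dilate z.2 a) (t + Real.log z.2)) W (𝓝 0) := by
    refine squeeze_zero_norm' ?_ h3
    filter_upwards [hWP, hW1.eventually eventually_prime_essentialPrimes,
      hW2.eventually eventually_prime_essentialPrimes] with z hz hz1 hz2
    rw [h.dilate_eq a ha _ _ hz1 hz2 hz.1]
    refine (h.lipschitz _ (h.dilate_mem a ha _ hz2) M (fun n => hM _) _ _).trans (le_of_eq ?_)
    congr 2
    ring
  exact sub_eq_zero.1 (tendsto_nhds_unique (h1.sub h2) h4)

/-- The group of common periods is not discrete. -/
theorem commonPeriods_ne_closure_singleton [Finite ι] (h : IsMeanSystem 𝒜 F κ) {α : ℝ}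
    (hα : α ≠ 0) : commonPeriods 𝒜 F ≠ AddSubgroup.closure {α} := by
  intro hU
  have hmul : ∀ n : ℤ, (n : ℝ) * α ∈ commonPeriods 𝒜 F := fun n => by
    rw [hU]
    exact AddSubgroup.mem_closure_singleton.2 ⟨n, by simp⟩
  set f : ℕ → ℝ := fun p => Int.fract (Real.log p / α) with hf
  have hlog : ∀ p : ℕ, Real.log p = α * f p + ⌊Real.log p / α⌋ * α := fun p => by
    rw [mul_comm α, ← add_mul, hf, Int.fract_add_floor, div_mul_cancel₀ _ hα]
  have hlim : ∀ V : Ultrafilter ℕ, ∃ c, Tendsto f V (𝓝 c) := fun V => by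
    obtain ⟨c, -, hc⟩ := (isCompact_Icc (a := (0 : ℝ)) (b := 1)).ultrafilter_le_nhds (V.map f)
      (le_principal_iff.2 (mem_map.2 (univ_mem' fun p =>
        ⟨Int.fract_nonneg _, (Int.fract_lt_one _).le⟩)))
    exact ⟨c, hc⟩
  -- As `α` is a period, `log p` may be replaced by `α * f p`, which converges along `V`.
  have hshift : ∀ V : Ultrafilter ℕ, (V : Filter ℕ) ≤ essentialPrimes → ∀ c, Tendsto f V (𝓝 c) →
      ∀ q : ℕ, q.Prime → (∀ᶠ p in (V : Filter ℕ), κ p = κ q) → ∀ a ∈ 𝒜, ∀ t,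
        F (dilate q a) (t + α * c) = F a t := by
    intro V hV c hc q hq hVq a ha t
    have h1 := (h.tendsto a ha t).mono_left hV
    have h2 : Tendsto (fun p => F (dilate q a) (t + α * f p)) V
        (𝓝 (F (dilate q a) (t + α * c))) :=
      ((h.continuous (h.dilate_mem a ha q hq)).tendsto _).comp
        (tendsto_const_nhds.add (hc.const_mul α))
    refine tendsto_nhds_unique (h2.congr' ?_) h1
    filter_upwards [hVq, hV eventually_prime_essentialPrimes] with p hp hp'
    rw [h.dilate_eq a ha p q hp' hq hp, hlog p, ← add_assoc,
      hmul _ _ (h.dilate_mem a ha q hq)]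
  -- Two limits of `f` within one colour differ by an integer, since `α` times their difference is a
  -- common period.
  have hc : ∀ i : ι, ∃ c : ℝ, ∀ V : Ultrafilter ℕ, (V : Filter ℕ) ≤ essentialPrimes →
      (∀ᶠ p in (V : Filter ℕ), κ p = i) → ∃ z : ℤ, Tendsto f V (𝓝 (c + z)) := by
    intro i
    by_cases hi : ∃ V : Ultrafilter ℕ, (V : Filter ℕ) ≤ essentialPrimes ∧
        ∀ᶠ p in (V : Filter ℕ), κ p = i
    · obtain ⟨V, hV, hVi⟩ := hi
      obtain ⟨c, hc⟩ := hlim V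
      refine ⟨c, fun V' hV' hVi' => ?_⟩
      obtain ⟨c', hc'⟩ := hlim V'
      obtain ⟨q, hqi, hq⟩ := (hVi.and (hV eventually_prime_essentialPrimes)).exists
      have hmem : α * (c' - c) ∈ commonPeriods 𝒜 F := fun a ha t => by
        rw [← hshift V hV c hc q hq (by simpa [hqi] using hVi) a ha (t + α * (c' - c)),
          ← hshift V' hV' c' hc' q hq (by simpa [hqi] using hVi') a ha t]
        congr 1
        ring
      rw [hU] at hmem
      obtain ⟨z, hz⟩ := AddSubgroup.mem_closure_singleton.1 hmem
      refine ⟨z, ?_⟩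
      have : c + z = c' := by
        rw [zsmul_eq_mul, mul_comm] at hz
        linarith [mul_left_cancel₀ hα hz]
      rwa [this]
    · exact ⟨0, fun V hV hVi => (hi ⟨V, hV, hVi⟩).elim⟩
  choose c hc using hc
  obtain ⟨k, hk, hcos⟩ := exists_pow_forall_half_le_cos c
  have hξ : 2 * Real.pi * k / α ≠ 0 := by
    have : (k : ℝ) ≠ 0 := by exact_mod_cast hk.ne'
    positivity
  refine not_eventually_half_le_cos_log hξ ?_
  rw [Filter.Eventually, mem_iff_ultrafilter]
  intro V hV
  obtain ⟨i, hi⟩ : ∃ i, ∀ᶠ p in (V : Filter ℕ), κ p = i := by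
    obtain ⟨i, hi⟩ := (V.map κ).eq_pure_of_finite
    refine ⟨i, ?_⟩
    have : ({i} : Set ι) ∈ V.map κ := hi ▸ Ultrafilter.mem_pure.2 rfl
    exact this
  obtain ⟨z, hz⟩ := hc i V hV hi
  have hper : ∀ (x : ℝ) (n : ℤ), Real.cos (2 * Real.pi * k * (x + n))
      = Real.cos (2 * Real.pi * k * x) := fun x n => by
    rw [← Real.cos_add_int_mul_two_pi (2 * Real.pi * k * x) (k * n)]
    congr 1
    push_cast
    ring
  have h1 : Tendsto (fun p => Real.cos (2 * Real.pi * k * f p)) V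
      (𝓝 (Real.cos (2 * Real.pi * k * c i))) := by
    rw [← hper (c i) z]
    exact (Real.continuous_cos.tendsto _).comp (hz.const_mul _)
  filter_upwards [h1.eventually_const_lt (hcos i)] with p hp
  refine hp.le.trans (le_of_eq ?_)
  rw [← hper (f p) ⌊Real.log p / α⌋]
  congr 1
  nth_rewrite 2 [hlog p]
  field_simp

/-- The mean value functions of a mean system with finitely many colours are constant. -/
theorem eq_const [Finite ι] (h : IsMeanSystem 𝒜 F κ) {a : ℕ → ℝ} (ha : a ∈ 𝒜) (t : ℝ) :
    F a t = F a 0 := by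
  rcases (commonPeriods 𝒜 F).dense_or_cyclic with hd | ⟨α, hα⟩
  · have hcl : IsClosed {u : ℝ | F a (0 + u) = F a 0} :=
      isClosed_eq ((h.continuous ha).comp (by fun_prop)) continuous_const
    have : closure (commonPeriods 𝒜 F : Set ℝ) ⊆ {u : ℝ | F a (0 + u) = F a 0} :=
      hcl.closure_subset_iff.2 fun u hu => hu a ha 0
    simpa using this (hd t)
  · by_cases hα0 : α = 0
    · obtain ⟨u, hu, hu0⟩ := h.exists_pos_mem_commonPeriods
      rw [hα, hα0, AddSubgroup.closure_singleton_zero, AddSubgroup.mem_bot] at hu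
      exact absurd hu hu0.ne'
    · exact absurd hα (h.commonPeriods_ne_closure_singleton hα0)

/-- Dilating by a prime whose colour is not sparse does not change the mean. -/
theorem dilate_zero [Finite ι] (h : IsMeanSystem 𝒜 F κ) {a : ℕ → ℝ} (ha : a ∈ 𝒜) {p : ℕ}
    (hp : p.Prime) (hκ : ¬ SparsePrimes {q | κ q = κ p}) : F (dilate p a) 0 = F a 0 := by
  -- Along primes `q` of the colour of `p`, `F (dilate q a) (log q)` is constantly `F (dilate p a)
  -- 0`, so this value is the limit `F a 0`.
  have hfr : ∃ᶠ q in essentialPrimes, κ q = κ p := fun h' => hκ (by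
    simpa using eventually_essentialPrimes.1 h')
  refine isClosed_singleton.mem_of_frequently_of_tendsto (s := {F (dilate p a) 0})
    ?_ (h.tendsto a ha 0) |>.symm
  refine (hfr.and_eventually eventually_prime_essentialPrimes).mono fun q hq => ?_
  rw [h.dilate_eq a ha q p hq.2 hp hq.1]
  exact h.eq_const (h.dilate_mem a ha p hp) _

end IsMeanSystem

/-! ### Means and the second moment of prime divisor counts -/

/-- The mean `(1 / x) ∑_{n ≤ x} a n`. -/
noncomputable def mean (a : ℕ → ℝ) (x : ℝ) : ℝ := 1 / x * ∑ n ∈ Finset.Icc 1 ⌊x⌋₊, a n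

theorem abs_sum_Icc_le {a : ℕ → ℝ} {M : ℝ} (hM : ∀ n, |a n| ≤ M) (N : ℕ) :
    |∑ n ∈ Finset.Icc 1 N, a n| ≤ N * M := by
  refine (Finset.abs_sum_le_sum_abs _ _).trans ((Finset.sum_le_card_nsmul _ _ M
    fun n _ => hM n).trans (le_of_eq ?_))
  simp

theorem abs_mean_le {a : ℕ → ℝ} {M : ℝ} (hM : ∀ n, |a n| ≤ M) {x : ℝ} (hx : 0 < x) :
    |mean a x| ≤ M := by
  have hM0 : 0 ≤ M := (abs_nonneg _).trans (hM 0)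
  rw [mean, abs_mul, abs_of_pos (by positivity : 0 < 1 / x), one_div_mul_eq_div, div_le_iff₀ hx]
  refine (abs_sum_Icc_le hM _).trans ?_
  rw [mul_comm]
  exact mul_le_mul_of_nonneg_left (Nat.floor_le hx.le) hM0

theorem abs_mean_sub_mean_le {a : ℕ → ℝ} {M : ℝ} (hM : ∀ n, |a n| ≤ M) {x x' : ℝ} (hx' : 0 < x')
    (h : x' ≤ x) : |mean a x - mean a x'| ≤ M * (2 * (1 - x' / x) + 1 / x) := by
  have hx : 0 < x := hx'.trans_le h
  have hM0 : 0 ≤ M := (abs_nonneg _).trans (hM 0)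
  have hfl : ⌊x'⌋₊ ≤ ⌊x⌋₊ := Nat.floor_le_floor h
  set A := ∑ n ∈ Finset.Icc 1 ⌊x'⌋₊, a n with hA
  set B := ∑ n ∈ Finset.Ioc ⌊x'⌋₊ ⌊x⌋₊, a n with hB
  have hsplit : ∑ n ∈ Finset.Icc 1 ⌊x⌋₊, a n = A + B := by
    have h0 : ∀ k : ℕ, Finset.Icc 1 k = Finset.Ioc 0 k := fun k => rfl
    rw [hA, hB, h0, h0, ← Finset.Ioc_union_Ioc_eq_Ioc (Nat.zero_le _) hfl, Finset.sum_union]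
    exact Finset.disjoint_left.2 fun p hp hp' =>
      absurd (Finset.mem_Ioc.1 hp).2 (not_le.2 (Finset.mem_Ioc.1 hp').1)
  have hBle : |B| ≤ (x - x' + 1) * M := by
    refine (Finset.abs_sum_le_sum_abs _ _).trans ((Finset.sum_le_card_nsmul _ _ M
      fun n _ => hM n).trans ?_)
    rw [Nat.card_Ioc, nsmul_eq_mul, Nat.cast_sub hfl]
    refine mul_le_mul_of_nonneg_right ?_ hM0
    linarith [Nat.floor_le hx.le, Nat.lt_floor_add_one x']
  have hAle : |A| ≤ x' * M := (abs_sum_Icc_le hM _).trans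
    (mul_le_mul_of_nonneg_right (Nat.floor_le hx'.le) hM0)
  have hinv : 1 / x ≤ 1 / x' := one_div_le_one_div_of_le hx' h
  have heq : mean a x - mean a x' = 1 / x * B - (1 / x' - 1 / x) * A := by
    rw [mean, mean, hsplit]; ring
  calc |mean a x - mean a x'| ≤ |1 / x * B| + |(1 / x' - 1 / x) * A| := by
        rw [heq]; exact abs_sub _ _
    _ = 1 / x * |B| + (1 / x' - 1 / x) * |A| := by
        rw [abs_mul, abs_mul, abs_of_pos (by positivity : 0 < 1 / x), abs_of_nonneg (sub_nonneg.2 hinv)]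
    _ ≤ 1 / x * ((x - x' + 1) * M) + (1 / x' - 1 / x) * (x' * M) := by
        have := sub_nonneg.2 hinv
        gcongr
    _ = M * (2 * (1 - x' / x) + 1 / x) := by
        field_simp
        ring

theorem mean_const_mul (c : ℝ) (a : ℕ → ℝ) (x : ℝ) :
    mean (fun n => c * a n) x = c * mean a x := by
  simp only [mean, ← Finset.mul_sum]
  ring

theorem mean_finset_sum {ι : Type*} (s : Finset ι) (a : ι → ℕ → ℝ) (x : ℝ) :
    mean (fun n => ∑ i ∈ s, a i n) x = ∑ i ∈ s, mean (a i) x := by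
  simp only [mean, Finset.mul_sum]
  rw [Finset.sum_comm]

theorem mean_add (a b : ℕ → ℝ) (x : ℝ) : mean (fun n => a n + b n) x = mean a x + mean b x := by
  simp only [mean, Finset.sum_add_distrib, mul_add]

/-- The indicator function of the multiples of `d`. -/
def dvdIndicator (d n : ℕ) : ℝ := if d ∣ n then 1 else 0

theorem mean_mul_dvdIndicator (a : ℕ → ℝ) {p : ℕ} (hp : 0 < p) (x : ℝ) :
    mean (fun n => a n * dvdIndicator p n) x = 1 / p * mean (dilate p a) (x / p) := by
  have hp' : (p : ℝ) ≠ 0 := by exact_mod_cast hp.ne'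
  have hsum : ∑ n ∈ Finset.Icc 1 ⌊x⌋₊, a n * dvdIndicator p n
      = ∑ n ∈ Finset.Icc 1 ⌊x / p⌋₊, dilate p a n := by
    rw [Nat.floor_div_natCast]
    simp only [dvdIndicator, mul_ite, mul_one, mul_zero, dilate]
    rw [← Finset.sum_filter]
    symm
    refine Finset.sum_bij (fun n _ => p * n) ?_ ?_ ?_ ?_
    · intro n hn
      obtain ⟨h1, h2⟩ := Finset.mem_Icc.1 hn
      refine Finset.mem_filter.2 ⟨Finset.mem_Icc.2 ⟨Nat.mul_pos hp h1, ?_⟩, dvd_mul_right _ _⟩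
      rw [mul_comm]
      exact (Nat.le_div_iff_mul_le hp).1 h2
    · intro n _ m _ h
      exact Nat.eq_of_mul_eq_mul_left hp h
    · intro n hn
      obtain ⟨h1, m, rfl⟩ := Finset.mem_filter.1 hn
      obtain ⟨h1, h2⟩ := Finset.mem_Icc.1 h1
      refine ⟨m, Finset.mem_Icc.2 ⟨Nat.pos_of_mul_pos_left h1, ?_⟩, rfl⟩
      rw [Nat.le_div_iff_mul_le hp, mul_comm]
      exact h2
    · intro n _
      rfl
  rw [mean, mean, hsum]
  rcases eq_or_ne x 0 with rfl | hx
  · simp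
  · field_simp

theorem tendsto_mean_dvdIndicator {d : ℕ} (hd : 0 < d) :
    Tendsto (mean (dvdIndicator d)) atTop (𝓝 (1 / d)) := by
  have h := tendsto_nat_floor_mul_div_atTop (R := ℝ) (a := 1 / d) (by positivity)
  refine h.congr fun x => ?_
  have h1 : mean (dvdIndicator d) x = mean (fun n => 1 * dvdIndicator d n) x := by simp
  rw [h1, mean_mul_dvdIndicator (fun _ => 1) hd]
  have hd' : (d : ℝ) ≠ 0 := by exact_mod_cast hd.ne'
  rcases eq_or_ne x 0 with rfl | hx
  · simp [mean]
  · simp [mean, dilate]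
    field_simp

/-- The weighted count `∑_{p ∈ B} c p (1 / p - 1_{p ∣ n})` of prime divisors, centred. -/
noncomputable def centredCount (B : Finset ℕ) (c : ℕ → ℝ) (n : ℕ) : ℝ :=
  ∑ p ∈ B, c p * (1 / p - dvdIndicator p n)

theorem dvdIndicator_mul_dvdIndicator (p q n : ℕ) :
    dvdIndicator p n * dvdIndicator q n = dvdIndicator (p.lcm q) n := by
  simp only [dvdIndicator, Nat.lcm_dvd_iff]
  by_cases hp : p ∣ n <;> by_cases hq : q ∣ n <;> simp [hp, hq]

/-- Divisibility by distinct primes is asymptotically independent, so the off-diagonal covariances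
vanish and only the variances remain. -/
theorem tendsto_mean_centredCount_sq {B : Finset ℕ} (hB : ∀ p ∈ B, p.Prime) (c : ℕ → ℝ) :
    Tendsto (mean fun n => centredCount B c n ^ 2) atTop
      (𝓝 (∑ p ∈ B, c p ^ 2 * (1 / p - 1 / (p : ℝ) ^ 2))) := by
  have hone : ∀ n, dvdIndicator 1 n = 1 := fun n => by simp [dvdIndicator]
  have hexp : (fun n => centredCount B c n ^ 2) = fun n => ∑ p ∈ B, ∑ q ∈ B, c p * c q *
      (1 / ((p : ℝ) * q) * dvdIndicator 1 n + ((-1 / (p : ℝ)) * dvdIndicator q n +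
        ((-1 / (q : ℝ)) * dvdIndicator p n + dvdIndicator (p.lcm q) n))) := by
    funext n
    rw [centredCount, sq, Finset.sum_mul_sum]
    refine Finset.sum_congr rfl fun p _ => Finset.sum_congr rfl fun q _ => ?_
    rw [← dvdIndicator_mul_dvdIndicator, hone]
    ring
  have hmean : (mean fun n => centredCount B c n ^ 2) = fun x => ∑ p ∈ B, ∑ q ∈ B, c p * c q *
      (1 / ((p : ℝ) * q) * mean (dvdIndicator 1) x + ((-1 / (p : ℝ)) * mean (dvdIndicator q) x +
        ((-1 / (q : ℝ)) * mean (dvdIndicator p) x + mean (dvdIndicator (p.lcm q)) x))) := by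
    funext x
    rw [hexp, mean_finset_sum]
    refine Finset.sum_congr rfl fun p _ => ?_
    rw [mean_finset_sum]
    refine Finset.sum_congr rfl fun q _ => ?_
    rw [mean_const_mul, mean_add, mean_const_mul, mean_add, mean_const_mul, mean_add,
      mean_const_mul]
  rw [hmean]
  refine tendsto_finsetSum _ fun p hp => ?_
  have hp0 : (p : ℝ) ≠ 0 := by exact_mod_cast (hB p hp).ne_zero
  have hval : c p ^ 2 * (1 / p - 1 / (p : ℝ) ^ 2) = ∑ q ∈ B, c p * c q *
      (1 / ((p : ℝ) * q) * (1 / (1 : ℕ)) + ((-1 / (p : ℝ)) * (1 / q) +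
        ((-1 / (q : ℝ)) * (1 / p) + 1 / (p.lcm q : ℕ)))) := by
    rw [Finset.sum_eq_single p]
    · rw [Nat.lcm_self]
      field_simp
      push_cast
      ring
    · intro q hq hqp
      have hq0 : (q : ℝ) ≠ 0 := by exact_mod_cast (hB q hq).ne_zero
      rw [((Nat.coprime_primes (hB p hp) (hB q hq)).2 hqp.symm).lcm_eq_mul]
      push_cast
      field_simp
      ring
    · exact fun h => absurd hp h
  rw [hval]
  refine tendsto_finsetSum _ fun q hq => Tendsto.const_mul _ ?_
  exact ((tendsto_mean_dvdIndicator one_pos).const_mul _).add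
    (((tendsto_mean_dvdIndicator (hB q hq).pos).const_mul _).add
    (((tendsto_mean_dvdIndicator (hB p hp).pos).const_mul _).add
    (tendsto_mean_dvdIndicator (Nat.lcm_pos (hB p hp).pos (hB q hq).pos))))

theorem mean_mul_le {a w : ℕ → ℝ} {M : ℝ} (hM : ∀ n, |a n| ≤ M) {x : ℝ} (hx : 0 < x) :
    mean (fun n => a n * w n) x ≤ M * √(mean (fun n => w n ^ 2) x) := by
  have hM0 : 0 ≤ M := (abs_nonneg _).trans (hM 0)
  have hw0 : 0 ≤ ∑ n ∈ Finset.Icc 1 ⌊x⌋₊, w n ^ 2 := Finset.sum_nonneg fun n _ => sq_nonneg _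
  have ha : ∑ n ∈ Finset.Icc 1 ⌊x⌋₊, a n ^ 2 ≤ x * M ^ 2 := by
    have h1 : ∑ n ∈ Finset.Icc 1 ⌊x⌋₊, a n ^ 2 ≤ ⌊x⌋₊ * M ^ 2 := by
      refine (Finset.sum_le_card_nsmul _ _ (M ^ 2) fun n _ => ?_).trans (le_of_eq ?_)
      · exact sq_le_sq' (abs_le.1 (hM n)).1 (abs_le.1 (hM n)).2
      · simp
    exact h1.trans (mul_le_mul_of_nonneg_right (Nat.floor_le hx.le) (sq_nonneg M))
  have hsq : mean (fun n => a n * w n) x ^ 2 ≤ M ^ 2 * mean (fun n => w n ^ 2) x := by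
    have hcs := Finset.sum_mul_sq_le_sq_mul_sq (Finset.Icc 1 ⌊x⌋₊) a w
    calc mean (fun n => a n * w n) x ^ 2
        = (1 / x) ^ 2 * (∑ n ∈ Finset.Icc 1 ⌊x⌋₊, a n * w n) ^ 2 := by rw [mean, mul_pow]
      _ ≤ (1 / x) ^ 2 * ((x * M ^ 2) * ∑ n ∈ Finset.Icc 1 ⌊x⌋₊, w n ^ 2) := by
          gcongr
          exact hcs.trans (mul_le_mul_of_nonneg_right ha hw0)
      _ = M ^ 2 * mean (fun n => w n ^ 2) x := by
          rw [mean]; field_simp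
  refine (Real.le_sqrt_of_sq_le hsq).trans (le_of_eq ?_)
  rw [Real.sqrt_mul (sq_nonneg M), Real.sqrt_sq hM0]

/-- Turns the weighted sum of differences into a correlation of `a` with `centredCount`, to which
Cauchy–Schwarz (`mean_mul_le`) applies. -/
theorem sum_mul_mean_sub_mean_dilate (a : ℕ → ℝ) {B : Finset ℕ} (hB : ∀ p ∈ B, p.Prime)
    (c : ℕ → ℝ) (x : ℝ) :
    ∑ p ∈ B, c p * (1 / p) * (mean a x - mean (dilate p a) (x / p))
      = mean (fun n => a n * centredCount B c n) x := by
  have h : (fun n => a n * centredCount B c n) = fun n => ∑ p ∈ B, (c p * (1 / p) * a n +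
      -c p * (a n * dvdIndicator p n)) := by
    funext n
    rw [centredCount, Finset.mul_sum]
    exact Finset.sum_congr rfl fun p _ => by ring
  rw [h, mean_finset_sum]
  refine Finset.sum_congr rfl fun p hp => ?_
  rw [mean_add, mean_const_mul, mean_const_mul, mean_mul_dvdIndicator a (hB p hp).pos]
  ring

/-! ### Limits of means and Turán–Kubilius -/

section Limit

variable {l : Filter ℕ} {F : (ℕ → ℝ) → ℝ → ℝ}

theorem tendsto_natCast_mul_exp_neg (t : ℝ) :
    Tendsto (fun N : ℕ => (N : ℝ) * Real.exp (-t)) atTop atTop :=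
  tendsto_natCast_atTop_atTop.atTop_mul_const (Real.exp_pos _)

theorem abs_sub_le_of_tendsto_mean [l.NeBot] (hl : l ≤ atTop) {a : ℕ → ℝ}
    (ha : ∀ t, Tendsto (fun N : ℕ => mean a (N * Real.exp (-t))) l (𝓝 (F a t)))
    {M : ℝ} (hM : ∀ n, |a n| ≤ M) (s t : ℝ) : |F a s - F a t| ≤ 2 * M * |s - t| := by
  wlog hst : s ≤ t generalizing s t
  · rw [abs_sub_comm, abs_sub_comm s]
    exact this t s (not_le.1 hst).le
  have hM0 : 0 ≤ M := (abs_nonneg _).trans (hM 0)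
  have hlim : Tendsto (fun N : ℕ => M * (2 * (t - s) + 1 / (N * Real.exp (-s)))) l
      (𝓝 (M * (2 * (t - s) + 0))) := by
    refine ((tendsto_const_nhds.add ?_).const_mul M)
    simp only [one_div]
    exact ((tendsto_natCast_mul_exp_neg s).mono_left hl).inv_tendsto_atTop
  have hle : ∀ᶠ N : ℕ in l, |mean a (N * Real.exp (-s)) - mean a (N * Real.exp (-t))| ≤
      M * (2 * (t - s) + 1 / (N * Real.exp (-s))) := by
    filter_upwards [hl (eventually_gt_atTop 0)] with N hN
    have hN : (0 : ℝ) < N := by exact_mod_cast hN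
    refine (abs_mean_sub_mean_le hM (by positivity) (mul_le_mul_of_nonneg_left
      (Real.exp_le_exp.2 (neg_le_neg hst)) hN.le)).trans ?_
    rw [mul_div_mul_left _ _ hN.ne', ← Real.exp_sub]
    have := Real.add_one_le_exp (-t - -s)
    refine mul_le_mul_of_nonneg_left ?_ hM0
    linarith
  have := le_of_tendsto_of_tendsto ((ha s).sub (ha t)).abs hlim hle
  rw [abs_of_nonpos (by linarith : s - t ≤ 0)]
  linarith

/-- A form of the Turán–Kubilius inequality. -/
theorem sum_mul_sub_dilate_le [l.NeBot] (hl : l ≤ atTop) {a : ℕ → ℝ} {B : Finset ℕ}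
    (hB : ∀ p ∈ B, p.Prime)
    (ha : ∀ t, Tendsto (fun N : ℕ => mean a (N * Real.exp (-t))) l (𝓝 (F a t)))
    (hd : ∀ p ∈ B, ∀ t, Tendsto (fun N : ℕ => mean (dilate p a) (N * Real.exp (-t))) l
      (𝓝 (F (dilate p a) t)))
    {M : ℝ} (hM : ∀ n, |a n| ≤ M) {c : ℕ → ℝ} (hc : ∀ p, |c p| ≤ 1) (t : ℝ) :
    ∑ p ∈ B, c p * (1 / p) * (F a t - F (dilate p a) (t + Real.log p))
      ≤ M * √(∑ p ∈ B, 1 / (p : ℝ)) := by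
  have hM0 : 0 ≤ M := (abs_nonneg _).trans (hM 0)
  have hx := (tendsto_natCast_mul_exp_neg t).mono_left hl
  have h1 : Tendsto (fun N : ℕ => ∑ p ∈ B, c p * (1 / p) * (mean a (N * Real.exp (-t)) -
      mean (dilate p a) (N * Real.exp (-t) / p))) l
      (𝓝 (∑ p ∈ B, c p * (1 / p) * (F a t - F (dilate p a) (t + Real.log p)))) := by
    refine tendsto_finsetSum _ fun p hp => ((ha t).sub ?_).const_mul _
    refine (hd p hp (t + Real.log p)).congr fun N => ?_
    have hp0 : (0 : ℝ) < p := by exact_mod_cast (hB p hp).pos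
    rw [neg_add, Real.exp_add, Real.exp_neg (Real.log p), Real.exp_log hp0, mul_div_assoc,
      div_eq_mul_inv]
  -- With `B` fixed as `N` grows, the second moment has an exact limit, so no error term depending
  -- on `B` appears.
  have h2 := (((tendsto_mean_centredCount_sq hB c).comp hx).sqrt).const_mul M
  have h3 := le_of_tendsto_of_tendsto h1 h2 (by
    filter_upwards [hx.eventually (eventually_gt_atTop 0)] with N hN
    rw [sum_mul_mean_sub_mean_dilate a hB]
    exact mean_mul_le hM hN)
  refine h3.trans (mul_le_mul_of_nonneg_left (Real.sqrt_le_sqrt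
    (Finset.sum_le_sum fun p hp => ?_)) hM0)
  have hp1 : c p ^ 2 ≤ 1 := (sq_le_one_iff_abs_le_one _).2 (hc p)
  have h4 : 0 ≤ 1 / (p : ℝ) - 1 / (p : ℝ) ^ 2 := by
    have : (1 : ℝ) ≤ p := by exact_mod_cast (hB p hp).one_lt.le
    refine sub_nonneg.2 (one_div_le_one_div_of_le (by positivity) ?_)
    nlinarith
  have h5 : 0 ≤ 1 / (p : ℝ) ^ 2 := by positivity
  nlinarith

/-- Let `H` be the reciprocal sum of finitely many primes where the deviation is at least `ε`.
Taking the signs of the deviations as weights in Turán–Kubilius gives `ε H ≤ M √H`, so `H ≤ (M / ε)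
^ 2`. -/
theorem tendsto_dilate_essentialPrimes [l.NeBot] (hl : l ≤ atTop) {a : ℕ → ℝ}
    (ha : ∀ t, Tendsto (fun N : ℕ => mean a (N * Real.exp (-t))) l (𝓝 (F a t)))
    (hd : ∀ p : ℕ, p.Prime → ∀ t, Tendsto (fun N : ℕ => mean (dilate p a) (N * Real.exp (-t))) l
      (𝓝 (F (dilate p a) t)))
    {M : ℝ} (hM : ∀ n, |a n| ≤ M) (t : ℝ) :
    Tendsto (fun p : ℕ => F (dilate p a) (t + Real.log p)) essentialPrimes (𝓝 (F a t)) := by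
  rw [Metric.tendsto_nhds]
  intro ε hε
  refine eventually_essentialPrimes.2 (sparsePrimes_of_sum_le ((M / ε) ^ 2) fun T hT => ?_)
  set D : ℕ → ℝ := fun p => F a t - F (dilate p a) (t + Real.log p) with hD
  have hTK := sum_mul_sub_dilate_le hl (fun p hp => (hT p hp).1) ha
    (fun p hp => hd p (hT p hp).1) hM (c := fun p => (SignType.sign (D p) : ℝ))
    (fun p => by rcases lt_trichotomy (D p) 0 with h | h | h <;> simp [h]) t
  set H := ∑ p ∈ T, 1 / (p : ℝ) with hH
  have hH0 : 0 ≤ H := Finset.sum_nonneg fun p _ => by positivity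
  have h1 : ε * H ≤ M * √H := by
    refine le_trans ?_ hTK
    rw [hH, Finset.mul_sum]
    refine Finset.sum_le_sum fun p hp => ?_
    have h2 : ε ≤ |D p| := by
      have := (hT p hp).2
      simp only [Set.mem_ofPred_eq, not_lt, Real.dist_eq] at this
      rwa [abs_sub_comm] at this
    rw [← sign_mul_self] at h2
    have h3 : 0 ≤ 1 / (p : ℝ) := by positivity
    nlinarith
  have hsq := Real.mul_self_sqrt hH0
  rcases (Real.sqrt_nonneg H).eq_or_lt with h0 | h0
  · have hH' : H = 0 := by rw [← hsq, ← h0, mul_zero]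
    rw [hH']
    positivity
  · have h2 : √H ≤ M / ε := by
      rw [le_div_iff₀ hε]
      refine le_of_mul_le_mul_right ?_ h0
      linarith [show √H * ε * √H = ε * H by linear_combination ε * hsq, h1,
        show M / ε * ε = M from div_mul_cancel₀ _ hε.ne']
    calc H = √H ^ 2 := by rw [sq, hsq]
      _ ≤ _ := by gcongr

end Limit

/-! ### Orbit sequences as a mean system -/

/-- The values of `g` along the orbit of `y`, with the value `0` at the index `0`. -/
def orbitSeq {Y : Type*} [TopologicalSpace Y] (S : ℕ → Y → Y) (y : Y) (g : C(Y, ℝ)) (n : ℕ) : ℝ :=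
  if n = 0 then 0 else g (S n y)

theorem orbitSeq_of_pos {Y : Type*} [TopologicalSpace Y] (S : ℕ → Y → Y) (y : Y) (g : C(Y, ℝ))
    {n : ℕ} (hn : 0 < n) : orbitSeq S y g n = g (S n y) := if_neg hn.ne'

theorem abs_orbitSeq_le {Y : Type*} [TopologicalSpace Y] [CompactSpace Y] (S : ℕ → Y → Y) (y : Y)
    (g : C(Y, ℝ)) (n : ℕ) : |orbitSeq S y g n| ≤ ‖g‖ := by
  rw [orbitSeq]
  split_ifs
  · simp
  · exact g.norm_coe_le_norm _

theorem IsMulSystem.dilate_orbitSeq {Y : Type*} [TopologicalSpace Y] {S : ℕ → Y → Y}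
    (hS : IsMulSystem S) (y : Y) (g : C(Y, ℝ)) {p : ℕ} (hp : 0 < p) :
    dilate p (orbitSeq S y g) = orbitSeq S y (g.comp ⟨S p, hS.continuous p hp⟩) := by
  funext n
  rcases n.eq_zero_or_pos with rfl | hn
  · simp [dilate, orbitSeq]
  · simp [dilate, orbitSeq, hS.map_mul n p hn hp, hn.ne', hp.ne']

theorem IsFinitelyGenerated.exists_colouring {Y : Type*} [TopologicalSpace Y] {S : ℕ → Y → Y}
    (hfg : IsFinitelyGenerated S) : ∃ (d : ℕ) (κ : ℕ → Fin d), ∀ p q : ℕ, p.Prime → q.Prime →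
      κ p = κ q → S p = S q := by
  obtain ⟨d, R, -, hR⟩ := hfg
  have h : ∀ p : ℕ, ∃ i, p.Prime → S p = R i := fun p => by
    by_cases hp : p.Prime
    · exact (hR p hp).imp fun i hi _ => hi
    · exact (hR 2 Nat.prime_two).imp fun i _ h => absurd h hp
  choose κ hκ using h
  exact ⟨d, κ, fun p q hp hq h => by rw [hκ p hp, hκ q hq, h]⟩

theorem exists_tendsto_mean {U : Ultrafilter ℕ} (hU : (U : Filter ℕ) ≤ atTop) {a : ℕ → ℝ} {M : ℝ}
    (hM : ∀ n, |a n| ≤ M) (t : ℝ) :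
    ∃ L, Tendsto (fun N : ℕ => mean a (N * Real.exp (-t))) U (𝓝 L) := by
  obtain ⟨L, -, hL⟩ := (isCompact_Icc (a := -M) (b := M)).ultrafilter_le_nhds
    (U.map fun N : ℕ => mean a (N * Real.exp (-t))) (le_principal_iff.2 (mem_map.2 (by
      filter_upwards [hU (eventually_gt_atTop 0)] with N hN
      have hN : (0 : ℝ) < N := by exact_mod_cast hN
      exact abs_le.1 (abs_mean_le hM (by positivity)))))
  exact ⟨L, hL⟩

/-- Asymptotic means along orbits of a finitely generated system do not change when the system is
moved by `S p`, unless the primes acting like `p` are sparse. -/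
theorem IsMulSystem.tendsto_mean_orbitSeq_comp {Y : Type*} [TopologicalSpace Y] [CompactSpace Y]
    {S : ℕ → Y → Y} (hS : IsMulSystem S) {ι : Type*} [Finite ι] {κ : ℕ → ι}
    (hκ : ∀ p q : ℕ, p.Prime → q.Prime → κ p = κ q → S p = S q) {p : ℕ} (hp : p.Prime)
    (hsp : ¬ SparsePrimes {q | κ q = κ p}) (y : Y) {U : Ultrafilter ℕ}
    (hU : (U : Filter ℕ) ≤ atTop) (g : C(Y, ℝ)) {L : ℝ}
    (hL : Tendsto (fun N : ℕ => mean (orbitSeq S y g) N) U (𝓝 L)) :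
    Tendsto (fun N : ℕ => mean (orbitSeq S y (g.comp ⟨S p, hS.continuous p hp.pos⟩)) N) U
      (𝓝 L) := by
  -- The limit exists for each orbit sequence, since bounded means converge along an ultrafilter;
  -- the default value of `limUnder` never matters.
  set F : (ℕ → ℝ) → ℝ → ℝ :=
    fun a t => limUnder (U : Filter ℕ) fun N : ℕ => mean a (N * Real.exp (-t)) with hF
  have hlim : ∀ g t, Tendsto (fun N : ℕ => mean (orbitSeq S y g) (N * Real.exp (-t))) U
      (𝓝 (F (orbitSeq S y g) t)) := fun g t =>
    tendsto_nhds_limUnder (exists_tendsto_mean hU (abs_orbitSeq_le S y g) t)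
  have hsys : IsMeanSystem (Set.range (orbitSeq S y)) F κ :=
    { bounded := by
        rintro _ ⟨g, rfl⟩
        exact ⟨_, abs_orbitSeq_le S y g⟩
      dilate_mem := by
        rintro _ ⟨g, rfl⟩ q hq
        exact ⟨_, (hS.dilate_orbitSeq y g hq.pos).symm⟩
      dilate_eq := by
        rintro _ ⟨g, rfl⟩ q r hq hr hqr
        rw [hS.dilate_orbitSeq y g hq.pos, hS.dilate_orbitSeq y g hr.pos]
        simp only [hκ q r hq hr hqr]
      lipschitz := by
        rintro _ ⟨g, rfl⟩ M hM s t
        exact abs_sub_le_of_tendsto_mean hU (hlim g) hM s t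
      tendsto := by
        rintro _ ⟨g, rfl⟩ t
        refine tendsto_dilate_essentialPrimes hU (hlim g) (fun q hq t => ?_)
          (abs_orbitSeq_le S y g) t
        rw [hS.dilate_orbitSeq y g hq.pos]
        exact hlim _ t }
  have hlim0 : ∀ g, Tendsto (fun N : ℕ => mean (orbitSeq S y g) N) U
      (𝓝 (F (orbitSeq S y g) 0)) := fun g => by simpa using hlim g 0
  have h := hsys.dilate_zero ⟨g, rfl⟩ hp hsp
  rw [tendsto_nhds_unique hL (hlim0 g), ← h, hS.dilate_orbitSeq y g hp.pos]
  exact hlim0 _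

/-! ### Empirical measures and the conclusion -/

/-- The empirical measures along an orbit. -/
theorem exists_empirical {Y : Type*} [TopologicalSpace Y] [CompactSpace Y] [MeasurableSpace Y]
    [BorelSpace Y] (S : ℕ → Y → Y) (y : Y) (N : ℕ) : ∃ e : ProbabilityMeasure Y, 0 < N →
      ∀ g : C(Y, ℝ), ∫ x, g x ∂(e : Measure Y) = mean (orbitSeq S y g) N := by
  rcases N.eq_zero_or_pos with rfl | hN
  · exact ⟨⟨Measure.dirac y, inferInstance⟩, fun h => absurd h (lt_irrefl 0)⟩
  have hN' : (N : ENNReal) ≠ 0 := by exact_mod_cast hN.ne'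
  refine ⟨⟨(N : ENNReal)⁻¹ • ∑ n ∈ Finset.Icc 1 N, Measure.dirac (S n y), ⟨?_⟩⟩, fun _ g => ?_⟩
  · simp [ENNReal.inv_mul_cancel hN' (ENNReal.natCast_ne_top N)]
  · have hint : ∀ n ∈ Finset.Icc 1 N, Integrable g (Measure.dirac (S n y)) := fun n _ =>
      g.continuous.integrable_of_hasCompactSupport (HasCompactSupport.of_compactSpace g)
    have hdirac : ∀ z : Y, ∫ x, g x ∂(Measure.dirac z) = g z := fun z =>
      integral_dirac' _ _ g.continuous.stronglyMeasurable
    rw [ProbabilityMeasure.coe_mk, integral_smul_measure, integral_finsetSum_measure hint, mean,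
      Nat.floor_natCast]
    simp only [ENNReal.toReal_inv, ENNReal.toReal_natCast, smul_eq_mul, one_div, hdirac]
    congr 1
    exact Finset.sum_congr rfl fun n hn => (orbitSeq_of_pos S y g (Finset.mem_Icc.1 hn).1).symm

/-- The exceptional primes lie in a union of finitely many sparse colour classes, which is sparse.
-/
theorem pretendsInvariant_of_forall_colour {Y : Type*} [MeasurableSpace Y] {S : ℕ → Y → Y}
    {μ : Measure Y} {ι : Type*} [Finite ι] (κ : ℕ → ι)
    (h : ∀ p : ℕ, p.Prime → ¬ SparsePrimes {q | κ q = κ p} → MeasurePreserving (S p) μ μ) :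
    PretendsInvariant S μ := by
  refine ⟨{p | p.Prime ∧ ¬ SparsePrimes {q | κ q = κ p}}, fun p hp => hp.1, ?_,
    fun p hp => h p hp.1 hp.2⟩
  have h1 : ∀ᶠ p in essentialPrimes, ∀ i, SparsePrimes {q | κ q = i} → κ p ≠ i := by
    refine eventually_all.2 fun i => ?_
    by_cases hi : SparsePrimes {q | κ q = i}
    · exact eventually_essentialPrimes.2 (hi.mono fun q hq => by
        simpa [hi] using hq)
    · exact Eventually.of_forall fun p h => absurd h hi
  have h2 := eventually_essentialPrimes.1 h1
  have h3 : SparsePrimes {p | ¬ (p.Prime ∧ ¬ SparsePrimes {q | κ q = κ p})} := by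
    refine (h2.union (eventually_essentialPrimes.1 eventually_prime_essentialPrimes)).mono ?_
    intro p hp
    by_cases hpp : p.Prime
    · exact Or.inl fun h4 => hp ⟨hpp, fun h5 => h4 _ h5 rfl⟩
    · exact Or.inr hpp
  exact summable_subtype_iff_indicator.2 h3

theorem measurePreserving_of_forall_integral_comp_eq {Y : Type*} [MetricSpace Y] [CompactSpace Y]
    [MeasurableSpace Y] [BorelSpace Y] {μ : Measure Y} [IsProbabilityMeasure μ] {T : Y → Y}
    (hT : Continuous T) (h : ∀ g : C(Y, ℝ), ∫ x, g (T x) ∂μ = ∫ x, g x ∂μ) :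
    MeasurePreserving T μ μ := by
  refine ⟨hT.measurable, ?_⟩
  have : IsProbabilityMeasure (μ.map T) :=
    Measure.isProbabilityMeasure_map hT.measurable.aemeasurable
  refine ext_of_forall_integral_eq_of_IsFiniteMeasure fun f => ?_
  rw [integral_map hT.measurable.aemeasurable f.continuous.aestronglyMeasurable]
  exact h f.toContinuousMap

/-- The real-valued case of the main theorem. -/
theorem tendsto_mean_orbitSeq {Y : Type*} [MetricSpace Y] [CompactSpace Y] [MeasurableSpace Y]
    [BorelSpace Y] {S : ℕ → Y → Y} (hS : IsMulSystem S) (hfg : IsFinitelyGenerated S)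
    (hsue : IsStronglyUniquelyErgodic S) {ν : Measure Y} [IsProbabilityMeasure ν]
    (hν : PretendsInvariant S ν) (y : Y) (g : C(Y, ℝ)) :
    Tendsto (fun N : ℕ => mean (orbitSeq S y g) N) atTop (𝓝 (∫ x, g x ∂ν)) := by
  obtain ⟨d, κ, hκ⟩ := hfg.exists_colouring
  choose e he using exists_empirical S y
  rw [tendsto_iff_ultrafilter]
  intro U hU
  -- The space of probability measures on the compact space `Y` is compact, so the ultrafilter has a
  -- limit.
  have hμ : Tendsto e U (𝓝 (U.map e).lim) := (U.map e).le_nhds_lim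
  set μ : ProbabilityMeasure Y := (U.map e).lim
  have hlim : ∀ g : C(Y, ℝ), Tendsto (fun N : ℕ => mean (orbitSeq S y g) N) U
      (𝓝 (∫ x, g x ∂(μ : Measure Y))) := fun g => by
    have := ProbabilityMeasure.tendsto_iff_forall_integral_tendsto.1 hμ
      (BoundedContinuousFunction.mkOfCompact g)
    refine this.congr' ?_
    filter_upwards [hU (eventually_gt_atTop 0)] with N hN
    exact he N hN g
  have hpre : PretendsInvariant S (μ : Measure Y) := by
    refine pretendsInvariant_of_forall_colour κ fun p hp hsp => ?_
    refine measurePreserving_of_forall_integral_comp_eq (hS.continuous p hp.pos) fun g => ?_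
    exact tendsto_nhds_unique (hlim _) (hS.tendsto_mean_orbitSeq_comp hκ hp hsp y hU g (hlim g))
  have heq : μ = ⟨ν, inferInstance⟩ := hsue.unique hpre hν
  have := hlim g
  rwa [heq] at this

theorem theoremB {Y : Type*} [MetricSpace Y] [CompactSpace Y] [MeasurableSpace Y] [BorelSpace Y]
    (S : ℕ → Y → Y) (hS : IsMulSystem S) (hfg : IsFinitelyGenerated S)
    (hsue : IsStronglyUniquelyErgodic S)
    (ν : Measure Y) [IsProbabilityMeasure ν] (hν : PretendsInvariant S ν)
    (y : Y) (g : C(Y, ℂ)) :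
    Tendsto (fun N : ℕ => (1 / (N : ℂ)) * ∑ n ∈ Finset.Icc 1 N, g (S n y)) atTop
      (𝓝 (∫ x, g x ∂ν)) := by
  set gr : C(Y, ℝ) := ⟨fun x => (g x).re, Complex.continuous_re.comp g.continuous⟩ with hgr
  set gi : C(Y, ℝ) := ⟨fun x => (g x).im, Complex.continuous_im.comp g.continuous⟩ with hgi
  have hint : Integrable g ν :=
    g.continuous.integrable_of_hasCompactSupport (HasCompactSupport.of_compactSpace g)
  have hr := tendsto_mean_orbitSeq hS hfg hsue hν y gr
  have hi := tendsto_mean_orbitSeq hS hfg hsue hν y gi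
  have h := ((Complex.continuous_ofReal.tendsto _).comp hr).add
    (((Complex.continuous_ofReal.tendsto _).comp hi).mul_const Complex.I)
  have hval : ((∫ x, gr x ∂ν : ℝ) : ℂ) + ((∫ x, gi x ∂ν : ℝ) : ℂ) * Complex.I = ∫ x, g x ∂ν :=
    integral_re_add_im hint
  rw [hval] at h
  refine h.congr fun N => ?_
  have hsum : ∀ f : C(Y, ℝ), mean (orbitSeq S y f) N
      = 1 / N * ∑ n ∈ Finset.Icc 1 N, f (S n y) := fun f => by
    rw [mean, Nat.floor_natCast]
    congr 1
    exact Finset.sum_congr rfl fun n hn => orbitSeq_of_pos S y f (Finset.mem_Icc.1 hn).1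
  simp only [Function.comp_apply, hsum]
  push_cast
  rw [mul_assoc, ← mul_add, Finset.sum_mul, ← Finset.sum_add_distrib]
  congr 1
  exact Finset.sum_congr rfl fun n _ => Complex.re_add_im _
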